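/- For a preordered set, "directed" includes nonempty. Given a poset $P$ and a new element $\infty\notin P$, let $\beta_P$ be the topology on $P\cup\{\infty\}$ with subbase all sets $\uparrow x$ and $\uparrow x\cup\{\infty\}$ ($x\in P$), and $\gamma_P$ the topology with subbase all sets $\uparrow x\cup\{\infty\}$ ($x\in P$), where $\uparrow x=\{y\in P: x\le y\}$. Let $\mathbb C_1=\mathbb D$, $\mathbb C_3=\mathbb I$, $\mathbb C_5=\mathbb N$ be the classes of all spaces $(P\cup\{\infty\},\beta_P)$ where $P$ ranges respectively over all directed posets, over all nonempty chains, and over $P=\mathbb N$ only; let $\mathbb C_2=\mathbb D'$, $\mathbb C_4=\mathbb I'$, $\mathbb C_6=\mathbb N'$ be the classes obtained in the same way with $\gamma_P$ in place of $\beta_P$. A topological space $X$ is $\mathbb C_i$-generated if a subset $U\subseteq X$ is open whenever $k^{-1}(U)$ is open for every continuous map $k:C\to X$ with $C\in\mathbb C_i$; $\mathbf{Top}_{\mathbb C_i}$ is the category of $\mathbb C_i$-generated spaces and continuous maps. Write $x\sqsubseteq y$ iff $x\in\overline{\{y\}}$. For a space $X$ let $\mathcal P_1=\mathcal D$, $\mathcal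 P_3=\mathcal I$, $\mathcal P_5=\mathcal N$ assign to $X$ the class of pairs $(\xi,x)$ with $x \in X$ and $\xi\to x$, where $\xi$ is respectively a directed subset of $(X,\sqsubseteq)$ (viewed as a net indexed by itself), a directed subset any two elements of which are comparable, and a sequence that is monotone for $\sqsubseteq$. Let $\mathcal P_2=\mathcal D'$, $\mathcal P_4=\mathcal I'$, $\mathcal P_6=\mathcal N'$ assign the class of pairs $(\xi,x)$ with $\xi$ of the same kind such that either $x\sqsubseteq y$ for some term $y$ of $\xi$, or $\xi\to x$ and every term $y$ of $\xi$ satisfies $y\sqsubseteq x$. A space $X$ is $\mathcal P_i$-determined if a subset $U$ is open iff for every pair $(\xi,x)$ of the class assigned to $X$ with $x\in U$, the net $\xi$ is eventually in $U$; $\mathbf{Top}_{\mathcal P_i}$ is the full subcategory of $\mathbf{Top}$ on these spaces. A space is monotone determined if a subset $U$ is open iff every net monotone for $\sqsubseteq$ that converges to a point of $U$ is eventually in $U$. **Theorem.** For each $1\le i\le 6$, the category $\mathbf{Top}_{\mathbb C_i}$ is cartesian closed (it has finite products and all exponential objects). Moreover, a space is $\mathbb C_i$-generated if and only if it is $\mathcal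 P_i$-determined, so $\mathbf{Top}_{\mathcal P_i}$ $(1\le i\le 6)$ is cartesian closed as well; in particular, the $\mathcal D$-determined spaces are exactly the monotone determined spaces, and these form a cartesian closed category. -/

import Mathlib

universe u

open CategoryTheory Topology Set Filter

namespace DeterminedSpace

/-! ### Nets, convergence classes and the topologies they determine -/

/-- A net in `X`: a map into `X` from a nonempty directed preordered set. -/
structure Net (X : Type u) where
  index : Type u
  [preorder : Preorder index]
  [directed : IsDirectedOrder index]
  [nonempty : Nonempty index]
  toFun : index → X

attribute [instance] Net.preorder Net.directed Net.nonempty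

/-- The net is eventually in `U`: from some index on, all its terms lie in `U`. -/
def Net.EventuallyIn {X : Type u} (ξ : Net X) (U : Set X) : Prop :=
  ∃ i : ξ.index, ∀ j : ξ.index, i ≤ j → ξ.toFun j ∈ U

/-- The net converges to `x`: it is eventually in every open set containing `x`. -/
def Net.ConvergesTo {X : Type u} [TopologicalSpace X] (ξ : Net X) (x : X) : Prop :=
  ∀ U : Set X, IsOpen U → x ∈ U → ξ.EventuallyIn U

/-- A convergence class on `X`: a class of pairs (net in `X`, point of `X`). -/
abbrev ConvergenceClass (X : Type u) := Set (Net X × X)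

/-- The topology determined by a convergence class `E`: a set `U` is open iff for all
`(ξ, x) ∈ E` with `x ∈ U`, the net `ξ` is eventually in `U`. -/
@[reducible]
def ConvergenceClass.topology {X : Type u} (E : ConvergenceClass X) : TopologicalSpace X where
  IsOpen U := ∀ ξ x, (ξ, x) ∈ E → x ∈ U → ξ.EventuallyIn U
  isOpen_univ := fun ξ _ _ _ => ⟨Classical.arbitrary ξ.index, fun _ _ => mem_univ _⟩
  isOpen_inter := fun U V hU hV ξ x h hx => by
    obtain ⟨i, hi⟩ := hU ξ x h hx.1
    obtain ⟨j, hj⟩ := hV ξ x h hx.2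
    obtain ⟨k, hik, hjk⟩ := exists_ge_ge i j
    exact ⟨k, fun l hl => ⟨hi l (hik.trans hl), hj l (hjk.trans hl)⟩⟩
  isOpen_sUnion := fun S hS ξ x h hx => by
    obtain ⟨U, hU, hxU⟩ := hx
    obtain ⟨i, hi⟩ := hS U hU ξ x h hxU
    exact ⟨i, fun j hj => ⟨U, hU, hi j hj⟩⟩

/-! ### The specialization order and nets that are monotone for it -/

/-- The specialization order: `x ⊑ y` iff `x` lies in the closure of `{y}`. -/
def SpecLE {X : Type u} [TopologicalSpace X] (x y : X) : Prop := x ∈ closure {y}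

/-- The specialization order as a preorder. -/
@[reducible]
def specPreorder (X : Type u) [TopologicalSpace X] : Preorder X where
  le := SpecLE
  le_refl x := subset_closure rfl
  le_trans x y z hxy hyz :=
    closure_minimal (singleton_subset_iff.2 hyz) isClosed_closure hxy

/-- Nets that are monotone for the specialization order. -/
def Net.IsMonotone {X : Type u} [TopologicalSpace X] (ξ : Net X) : Prop :=
  ∀ i j : ξ.index, i ≤ j → SpecLE (ξ.toFun i) (ξ.toFun j)

/-- A subset that is nonempty and directed in the specialization order. -/
def IsDirectedSubset {X : Type u} [TopologicalSpace X] (D : Set X) : Prop :=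
  D.Nonempty ∧ DirectedOn SpecLE D

/-- A pre-chain: a directed subset in which any two elements are comparable. -/
def IsPreChain {X : Type u} [TopologicalSpace X] (D : Set X) : Prop :=
  IsDirectedSubset D ∧ ∀ x ∈ D, ∀ y ∈ D, SpecLE x y ∨ SpecLE y x

/-- A directed subset `D`, viewed as the net `(d)_{d ∈ D}` indexed by `D` itself with the
specialization order. -/
def netOfDirected {X : Type u} [TopologicalSpace X] (D : Set X) (hD : IsDirectedSubset D) :
    Net X :=
  letI := specPreorder X
  { index := D
    preorder := inferInstance
    directed := ⟨fun a b => by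
      obtain ⟨c, hc, hac, hbc⟩ := hD.2 a a.2 b b.2
      exact ⟨⟨c, hc⟩, hac, hbc⟩⟩
    nonempty := hD.1.to_subtype
    toFun := Subtype.val }

/-- A sequence, viewed as a net. -/
def netOfSeq {X : Type u} (s : ℕ → X) : Net X where
  index := ULift.{u} ℕ
  directed := ⟨fun a b =>
    ⟨⟨max a.down b.down⟩, le_max_left a.down b.down, le_max_right a.down b.down⟩⟩
  toFun n := s n.down

/-! ### The six operations and the six generating classes -/

/-- Which posets / monotone nets are used: directed ones, chains, or the natural numbers. -/
inductive Shape
  | directed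
  | chain
  | nat

/-- Which topology (resp. which kind of convergence) is used: `β` for the unprimed classes and
operations, `γ` for the primed ones. -/
inductive Flavour
  | β
  | γ

/-- The convergence class of a flavour, restricted to given nets: for `β`, the pairs `(ξ, x)` with
`ξ → x`; for `γ`, those where `x` is below some term of `ξ`, or `ξ → x` and all terms of `ξ`
are below `x`. -/
def Flavour.Admits {X : Type u} [TopologicalSpace X] : Flavour → Net X → X → Prop
  | .β, ξ, x => ξ.ConvergesTo x
  | .γ, ξ, x => (∃ j, SpecLE x (ξ.toFun j)) ∨ (ξ.ConvergesTo x ∧ ∀ j, SpecLE (ξ.toFun j) x)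

/-- The nets of a given shape in a space: directed subsets, pre-chains, monotone sequences. -/
def Shape.nets (X : Type u) [TopologicalSpace X] : Shape → Set (Net X)
  | .directed => {ξ | ∃ (D : Set X) (hD : IsDirectedSubset D), ξ = netOfDirected D hD}
  | .chain => {ξ | ∃ (D : Set X) (hD : IsPreChain D), ξ = netOfDirected D hD.1}
  | .nat => {ξ | ∃ s : ℕ → X, (netOfSeq s).IsMonotone ∧ ξ = netOfSeq s}

/-- The six operations: `𝒟, 𝓘, 𝒩` (flavour `β`) and `𝒟', 𝓘', 𝒩'` (flavour `γ`). -/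
def operation (s : Shape) (f : Flavour) (X : Type u) [TopologicalSpace X] : ConvergenceClass X :=
  {p | p.1 ∈ s.nets X ∧ f.Admits p.1 p.2}

/-- The spaces determined by one of the six operations: those whose topology equals the topology
determined by the convergence class that the operation assigns to them. -/
def determinedBy (s : Shape) (f : Flavour) : ObjectProperty TopCat.{u} :=
  fun X => (operation s f X).topology = (inferInstance : TopologicalSpace X)

/-- Monotone determined spaces: a set `U` is open iff every monotone net that converges to a point
of `U` is eventually in `U`. -/
def monotoneDetermined : ObjectProperty TopCat.{u} :=
  fun X => ∀ U : Set X, IsOpen U ↔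
    ∀ ξ : Net X, ξ.IsMonotone → ∀ x ∈ U, ξ.ConvergesTo x → ξ.EventuallyIn U

/-- The posets of a given shape: nonempty directed posets, nonempty chains, or only `ℕ`. -/
def Shape.posets : Shape → Set PartOrd.{u}
  | .directed => {P | Nonempty P ∧ IsDirectedOrder P}
  | .chain => {P | Nonempty P ∧ ∀ x y : P, x ≤ y ∨ y ≤ x}
  | .nat => {PartOrd.of (ULift.{u} ℕ)}

/-- The set `P ∪ {∞}`, where `∞` is a new element. -/
inductive AddInfty (P : Type u) : Type u
  | of : P → AddInfty P
  | infty : AddInfty P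

/-- `↑x`, the set of all elements of `P` above `x`, as a subset of `P ∪ {∞}`. -/
def AddInfty.up {P : Type u} [PartialOrder P] (x : P) : Set (AddInfty P) :=
  AddInfty.of '' Ici x

/-- The topologies `β_P` (subbase: all `↑x` and all `↑x ∪ {∞}`) and `γ_P` (subbase: all
`↑x ∪ {∞}`) on `P ∪ {∞}`. -/
@[reducible]
def Flavour.topology (P : Type u) [PartialOrder P] : Flavour → TopologicalSpace (AddInfty P)
  | .β => TopologicalSpace.generateFrom
      ({S | ∃ x : P, S = AddInfty.up x} ∪ {S | ∃ x : P, S = AddInfty.up x ∪ {AddInfty.infty}})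
  | .γ => TopologicalSpace.generateFrom
      {S | ∃ x : P, S = AddInfty.up x ∪ {AddInfty.infty}}

/-- The generating class of shape `s` and flavour `f`, as a family of types indexed by the posets
of that shape. -/
def GeneratingSpace (s : Shape) (_f : Flavour) (P : s.posets.{u}) : Type u :=
  AddInfty (P : PartOrd.{u})

instance (s : Shape) (f : Flavour) (P : s.posets.{u}) :
    TopologicalSpace (GeneratingSpace s f P) :=
  f.topology (P : PartOrd.{u})

/-! ### Cartesian closed categories -/

/-- A category is cartesian closed if it has finite products, and every functor `A × -` has a
right adjoint (i.e. all exponential objects exist). -/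
def IsCartesianClosed (C : Type*) [Category C] : Prop :=
  ∃ _ : CartesianMonoidalCategory C, Nonempty (MonoidalClosed C)

end DeterminedSpace

namespace DeterminedSpace

/-! Cartesian closedness follows from the convenient-category criterion: it suffices that the test
spaces are locally compact and that their binary products are generated by them. Basic open sets are
tails `↑p`, possibly with `∞`, and `↑p` is compact because it has a least element. For products, a
set with open slices is already open (`isOpen_prod_addInfty`).

For generated = determined, a continuous map out of `P ∪ {∞}` is a monotone family on `P` converging
to the image of `∞`, which for `γ` is also an upper bound (`isOpen_addInfty_iff`,
`continuous_addInfty`). The index sets differ, since directed subsets are only preordered and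
families need not be injective. But the sets tested are upper sets, and a monotone net is eventually
in an upper set once it has one term there, so interleaved monotone families are interchangeable
(`isOpen_operation_iff`). -/

/-! ### Cartesian closedness of the category of generated spaces -/

section CartesianClosed

open Limits MonoidalCategory

universe v t w

variable {ι : Type t} {X : ι → Type w} [∀ i, TopologicalSpace (X i)]

/-- The one-point space is terminal in the category of `X`-continuous maps. -/
def isTerminalPUnit : IsTerminal (ContinuousGeneratedByCat.of (X := X) PUnit.{v + 1}) :=
  IsTerminal.ofUniqueHom
    (fun _ => ContinuousGeneratedByCat.homMk (fun _ => PUnit.unit)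
      continuous_const.continuousGeneratedBy)
    (fun _ _ => by ext)

/-- The topological product of two spaces, as a cone in the category of `X`-continuous maps. -/
def prodFan (Y Z : ContinuousGeneratedByCat.{v} X) : BinaryFan Y Z :=
  BinaryFan.mk (P := ContinuousGeneratedByCat.of (Y × Z))
    (ContinuousGeneratedByCat.homMk Prod.fst continuous_fst.continuousGeneratedBy)
    (ContinuousGeneratedByCat.homMk Prod.snd continuous_snd.continuousGeneratedBy)

/-- The topological product is a product in the category of `X`-continuous maps. -/
def isLimitProdFan (Y Z : ContinuousGeneratedByCat.{v} X) : IsLimit (prodFan Y Z) :=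
  BinaryFan.IsLimit.mk _
    (fun f g => ContinuousGeneratedByCat.homMk (fun t => (f t, g t))
      -- Continuity is only tested on maps from the `X i`, so the product topology needs no
      -- refinement here.
      (fun _ k => (f.hom.prop k).prodMk (g.hom.prop k)))
    (fun _ _ => rfl) (fun _ _ => rfl)
    (fun f g m hf hg => by
      subst hf hg
      rfl)

/-- The cartesian structure on the category of `X`-continuous maps given by topological
products. -/
@[reducible]
def cartesianContinuousGeneratedByCat :
    CartesianMonoidalCategory (ContinuousGeneratedByCat.{v} X) :=
  .ofChosenFiniteProducts ⟨_, isTerminalPUnit⟩ (fun Y Z => ⟨_, isLimitProdFan Y Z⟩)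

attribute [local instance] cartesianContinuousGeneratedByCat

variable [∀ i, LocallyCompactSpace (X i)] [∀ i j, IsGeneratedBy X (X i × X j)]

/-- Currying, as a bijection between sets of morphisms. -/
def curryHomEquiv (Y Z T : ContinuousGeneratedByCat.{v} X) :
    ((tensorLeft Y).obj Z ⟶ T) ≃
      (Z ⟶ ContinuousGeneratedByCat.of (ContinuousMapGeneratedBy X Y T)) where
  toFun f := ⟨ContinuousMapGeneratedBy.curryEquiv (Y := Y) (Z := Z) f.hom⟩
  invFun g := ⟨(ContinuousMapGeneratedBy.curryEquiv (Y := Y) (Z := Z)).symm g.hom⟩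
  left_inv _ := rfl
  right_inv _ := rfl

/-- If the spaces `X i` are locally compact and their binary products are `X`-generated, then the
category of `X`-continuous maps is cartesian closed. -/
@[reducible]
def monoidalClosedContinuousGeneratedByCat :
    MonoidalClosed (ContinuousGeneratedByCat.{v} X) where
  closed Y :=
    { rightAdj := _
      adj := Adjunction.adjunctionOfEquivRight (curryHomEquiv.{v} Y) (fun _ _ _ _ _ => rfl) }

/-- If the spaces `X i` are locally compact and their binary products are `X`-generated, then the
category of `X`-generated spaces is cartesian closed. -/
theorem isCartesianClosed_generatedByTopCat :
    IsCartesianClosed (GeneratedByTopCat.{v} X) :=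
  -- A product of generated spaces need not carry the product topology; the cartesian structure is
  -- chosen abstractly and closedness is transported along the equivalence with the category of
  -- `X`-continuous maps.
  letI := CartesianMonoidalCategory.ofHasFiniteProducts (C := GeneratedByTopCat.{v} X)
  letI := monoidalClosedContinuousGeneratedByCat.{v} (X := X)
  ⟨inferInstance, ⟨cartesianClosedOfEquiv ContinuousGeneratedByCat.equivalence.symm⟩⟩

end CartesianClosed

/-! ### The topologies on `P ∪ {∞}` -/

section AddInfty

variable {P : Type u} [PartialOrder P]

theorem mem_up_union_infty_of {x y : P} :
    AddInfty.of y ∈ AddInfty.up x ∪ {AddInfty.infty} ↔ x ≤ y := by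
  simp [AddInfty.up]

theorem of_mem_up {x y : P} : AddInfty.of y ∈ AddInfty.up x ↔ x ≤ y := by
  simp [AddInfty.up]

theorem infty_notMem_up {x : P} : AddInfty.infty ∉ AddInfty.up x := by
  simp [AddInfty.up]

/-- The tails `↑p` and `↑p ∪ {∞}` that are open form a neighborhood basis. -/
theorem exists_tail_subset (f : Flavour) {U : Set (AddInfty P)}
    (h₁ : ∀ p q : P, p ≤ q → AddInfty.of p ∈ U → AddInfty.of q ∈ U)
    (h₂ : AddInfty.infty ∈ U → ∃ p : P, ∀ q, p ≤ q → AddInfty.of q ∈ U)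
    (h₃ : f = .γ → ∀ p : P, AddInfty.of p ∈ U → AddInfty.infty ∈ U)
    {x : AddInfty P} (hx : x ∈ U) :
    ∃ V, IsOpen[f.topology P] V ∧ x ∈ V ∧ V ⊆ U ∧
      ∃ p, V = AddInfty.up p ∨ V = AddInfty.up p ∪ {AddInfty.infty} := by
  let := f.topology P
  have hopen : ∀ p : P, IsOpen (AddInfty.up p ∪ {AddInfty.infty}) := fun p => by
    cases f with
    | β => exact .basic _ (Or.inr ⟨p, rfl⟩)
    | γ => exact .basic _ ⟨p, rfl⟩
  rcases x with p | _
  · cases f with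
    | β =>
      refine ⟨AddInfty.up p, .basic _ (Or.inl ⟨p, rfl⟩), of_mem_up.2 le_rfl, ?_, p, Or.inl rfl⟩
      rintro _ ⟨q, hq, rfl⟩
      exact h₁ p q hq hx
    | γ =>
      refine ⟨_, hopen p, mem_up_union_infty_of.2 le_rfl, ?_, p, Or.inr rfl⟩
      rintro _ (⟨q, hq, rfl⟩ | rfl)
      · exact h₁ p q hq hx
      · exact h₃ rfl p hx
  · obtain ⟨p, h⟩ := h₂ hx
    refine ⟨_, hopen p, Or.inr rfl, ?_, p, Or.inr rfl⟩
    rintro _ (⟨q, hq, rfl⟩ | rfl)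
    · exact h q hq
    · exact hx

variable [Nonempty P] [IsDirectedOrder P]

/-- A set is open in `P ∪ {∞}` iff its part in `P` is an upper set, it contains a tail of `P` if it
contains `∞`, and, for the topology `γ`, it contains `∞` if it is nonempty. -/
theorem isOpen_addInfty_iff (f : Flavour) (U : Set (AddInfty P)) :
    IsOpen[f.topology P] U ↔
      (∀ p q : P, p ≤ q → AddInfty.of p ∈ U → AddInfty.of q ∈ U) ∧
      (AddInfty.infty ∈ U → ∃ p : P, ∀ q, p ≤ q → AddInfty.of q ∈ U) ∧
      (f = .γ → ∀ p : P, AddInfty.of p ∈ U → AddInfty.infty ∈ U) := by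
  constructor
  · intro hU
    -- An arbitrary `S` with bounded members stands in for the subbase, so one induction serves both
    -- flavours.
    have key : ∀ S : Set (Set (AddInfty P)),
        (∀ V ∈ S, ∃ x : P, V = AddInfty.up x ∪ {AddInfty.infty} ∨ f = .β ∧ V = AddInfty.up x) →
        TopologicalSpace.GenerateOpen S U →
        (∀ p q : P, p ≤ q → AddInfty.of p ∈ U → AddInfty.of q ∈ U) ∧
        (AddInfty.infty ∈ U → ∃ p : P, ∀ q, p ≤ q → AddInfty.of q ∈ U) ∧
        (f = .γ → ∀ p : P, AddInfty.of p ∈ U → AddInfty.infty ∈ U) := by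
      clear hU
      intro S hS h
      induction h with
      | basic V hV =>
        obtain ⟨x, rfl | ⟨rfl, rfl⟩⟩ := hS V hV
        · exact ⟨fun p q hpq hp => mem_up_union_infty_of.2 ((mem_up_union_infty_of.1 hp).trans hpq),
            fun _ => ⟨x, fun q hq => mem_up_union_infty_of.2 hq⟩, fun _ _ _ => Or.inr rfl⟩
        · exact ⟨fun p q hpq hp => of_mem_up.2 ((of_mem_up.1 hp).trans hpq),
            fun h => (infty_notMem_up h).elim, fun h => by cases h⟩
      | univ => exact ⟨fun _ _ _ _ => mem_univ _,
          fun _ => ⟨Classical.arbitrary P, fun _ _ => mem_univ _⟩, fun _ _ _ => mem_univ _⟩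
      | inter V W _ _ hV hW =>
        refine ⟨fun p q hpq h => ⟨hV.1 p q hpq h.1, hW.1 p q hpq h.2⟩, fun h => ?_,
          fun hf p h => ⟨hV.2.2 hf p h.1, hW.2.2 hf p h.2⟩⟩
        obtain ⟨a, ha⟩ := hV.2.1 h.1
        obtain ⟨b, hb⟩ := hW.2.1 h.2
        obtain ⟨c, hac, hbc⟩ := exists_ge_ge a b
        exact ⟨c, fun q hq => ⟨ha q (hac.trans hq), hb q (hbc.trans hq)⟩⟩
      | sUnion T _ hT =>
        refine ⟨fun p q hpq ⟨V, hV, h⟩ => ⟨V, hV, (hT V hV).1 p q hpq h⟩, fun ⟨V, hV, h⟩ => ?_,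
          fun hf p ⟨V, hV, h⟩ => ⟨V, hV, (hT V hV).2.2 hf p h⟩⟩
        obtain ⟨a, ha⟩ := (hT V hV).2.1 h
        exact ⟨a, fun q hq => ⟨V, hV, ha q hq⟩⟩
    cases f with
    | β =>
      refine key _ ?_ hU
      rintro V (⟨x, rfl⟩ | ⟨x, rfl⟩)
      · exact ⟨x, Or.inr ⟨rfl, rfl⟩⟩
      · exact ⟨x, Or.inl rfl⟩
    | γ =>
      refine key _ ?_ hU
      rintro V ⟨x, rfl⟩
      exact ⟨x, Or.inl rfl⟩
  · rintro ⟨h₁, h₂, h₃⟩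
    let := f.topology P
    refine isOpen_iff_forall_mem_open.2 fun x hx => ?_
    obtain ⟨V, hV, hxV, hVU, -⟩ := exists_tail_subset f h₁ h₂ h₃ hx
    exact ⟨V, hVU, hV, hxV⟩

/-- A map out of `P ∪ {∞}` is continuous if its restriction to `P` is monotone and converges to the
image of `∞`, which for the topology `γ` has to be an upper bound. -/
theorem continuous_addInfty {X : Type*} [TopologicalSpace X] (f : Flavour) (k : AddInfty P → X)
    (h₁ : ∀ p q : P, p ≤ q → SpecLE (k (.of p)) (k (.of q)))
    (h₂ : ∀ V : Set X, IsOpen V → k .infty ∈ V → ∃ p : P, ∀ q, p ≤ q → k (.of q) ∈ V)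
    (h₃ : f = .γ → ∀ p : P, SpecLE (k (.of p)) (k .infty)) :
    Continuous[f.topology P, _] k := by
  let := f.topology P
  refine continuous_def.2 fun V hV => (isOpen_addInfty_iff f _).2 ⟨?_, h₂ V hV, ?_⟩
  · exact fun p q hpq hp => specializes_iff_mem_closure.2 (h₁ p q hpq) |>.mem_open hV hp
  · exact fun hf p hp => specializes_iff_mem_closure.2 (h₃ hf p) |>.mem_open hV hp

/-- The spaces `P ∪ {∞}` are locally compact. -/
theorem locallyCompactSpace_addInfty (f : Flavour) :
    @LocallyCompactSpace (AddInfty P) (f.topology P) := by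
  let := f.topology P
  -- Every neighborhood of `p` contains `↑p`, so every proper filter on `↑p` clusters at `p`.
  have hup : ∀ p : P, IsCompact (AddInfty.up p) := fun p F _ hF => by
    refine ⟨.of p, of_mem_up.2 le_rfl, ClusterPt.of_le_nhds (hF.trans fun V hV => ?_)⟩
    obtain ⟨U, hUV, hU, hp⟩ := mem_nhds_iff.1 hV
    rintro _ ⟨q, hq, rfl⟩
    exact hUV (((isOpen_addInfty_iff f U).1 hU).1 p q hq hp)
  refine ⟨fun x n hn => ?_⟩
  obtain ⟨U, hUn, hU, hx⟩ := mem_nhds_iff.1 hn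
  obtain ⟨h₁, h₂, h₃⟩ := (isOpen_addInfty_iff f U).1 hU
  obtain ⟨V, hV, hxV, hVU, p, hp⟩ := exists_tail_subset f h₁ h₂ h₃ hx
  refine ⟨V, hV.mem_nhds hxV, hVU.trans hUn, ?_⟩
  obtain rfl | rfl := hp
  · exact hup p
  · exact (hup p).union isCompact_singleton

/-- Every point of `P ∪ {∞}` other than `∞` has a smallest neighborhood. -/
theorem isOpen_smallest_nhds (f : Flavour) (p : P) :
    IsOpen[f.topology P] {z | ∀ V, IsOpen[f.topology P] V → AddInfty.of p ∈ V → z ∈ V} := by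
  refine (isOpen_addInfty_iff f _).2 ⟨fun a b hab ha V hV hp => ?_, fun _ => ⟨p, ?_⟩, ?_⟩
  · exact ((isOpen_addInfty_iff f V).1 hV).1 a b hab (ha V hV hp)
  · exact fun q hq V hV hp => ((isOpen_addInfty_iff f V).1 hV).1 p q hq hp
  · exact fun hf a ha V hV hp => ((isOpen_addInfty_iff f V).1 hV).2.2 hf a (ha V hV hp)

/-- In a product `(P ∪ {∞}) × (Q ∪ {∞})`, a set is open if its slices are open. -/
theorem isOpen_prod_addInfty {Q : Type u} [PartialOrder Q] [Nonempty Q] [IsDirectedOrder Q]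
    (f : Flavour) (U : Set (AddInfty P × AddInfty Q))
    (hl : ∀ x, IsOpen[f.topology Q] {y | (x, y) ∈ U})
    (hr : ∀ y, IsOpen[f.topology P] {x | (x, y) ∈ U}) :
    IsOpen[@instTopologicalSpaceProd _ _ (f.topology P) (f.topology Q)] U := by
  let := f.topology P
  let := f.topology Q
  rw [isOpen_prod_iff]
  rintro (p | _) (y | _) hxy
  -- If one coordinate is not `∞`, its smallest neighborhood times the slice through it is a box
  -- inside `U`.
  · exact ⟨_, _, isOpen_smallest_nhds f p, hl (.of p), fun _ _ h => h, hxy,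
      fun z hz => hz.1 _ (hr z.2) hz.2⟩
  · exact ⟨_, _, isOpen_smallest_nhds f p, hl (.of p), fun _ _ h => h, hxy,
      fun z hz => hz.1 _ (hr z.2) hz.2⟩
  · exact ⟨_, _, hr (.of y), isOpen_smallest_nhds f y, hxy, fun _ _ h => h,
      fun z hz => hz.2 _ (hl z.1) hz.1⟩
  · obtain ⟨q, hq⟩ := ((isOpen_addInfty_iff f _).1 (hl .infty)).2.1 hxy
    -- If `x` lies in the slices at both `q` and `∞`, then `(x, b) ∈ U` for all `b ≥ q`, because the
    -- slice over `x` is an upper set.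
    refine ⟨_, AddInfty.up q ∪ {AddInfty.infty}, (hr (.of q)).inter (hr .infty),
      (isOpen_addInfty_iff f _).2 ⟨?_, fun _ => ⟨q, ?_⟩, fun _ _ _ => Or.inr rfl⟩,
      ⟨hq q le_rfl, hxy⟩, Or.inr rfl, ?_⟩
    · exact fun a b hab ha => mem_up_union_infty_of.2 ((mem_up_union_infty_of.1 ha).trans hab)
    · exact fun b hb => mem_up_union_infty_of.2 hb
    · rintro ⟨x, _⟩ ⟨hx, ⟨b, hb, rfl⟩ | rfl⟩
      · exact ((isOpen_addInfty_iff f _).1 (hl x)).1 q b hb hx.1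
      · exact hx.2

end AddInfty

/-! ### The generating spaces -/

section GeneratingSpace

variable {s : Shape} {f : Flavour}

theorem Shape.nonempty_of_mem_posets {P : PartOrd.{u}} (hP : P ∈ s.posets) : Nonempty P := by
  cases s with
  | directed => exact hP.1
  | chain => exact hP.1
  | nat => obtain rfl := hP; exact ⟨⟨0⟩⟩

theorem Shape.isDirectedOrder_of_mem_posets {P : PartOrd.{u}} (hP : P ∈ s.posets) :
    IsDirectedOrder P := by
  cases s with
  | directed => exact hP.2
  | chain =>
    exact ⟨fun a b => (hP.2 a b).elim (fun h => ⟨b, h, le_rfl⟩) fun h => ⟨a, le_rfl, h⟩⟩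
  | nat =>
    obtain rfl := hP
    exact ⟨fun a b => ⟨⟨max a.down b.down⟩, le_max_left a.down b.down, le_max_right a.down b.down⟩⟩

theorem Shape.nat_mem_posets (s : Shape) : PartOrd.of (ULift.{u} ℕ) ∈ s.posets := by
  have hdir := isDirectedOrder_of_mem_posets (s := .nat) (P := PartOrd.of (ULift.{u} ℕ)) rfl
  cases s with
  | directed => exact ⟨⟨⟨0⟩⟩, hdir⟩
  | chain => exact ⟨⟨⟨0⟩⟩, fun x y => le_total x.down y.down⟩
  | nat => rfl

instance (P : s.posets.{u}) : Nonempty (P : PartOrd.{u}) := s.nonempty_of_mem_posets P.2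

instance (P : s.posets.{u}) : IsDirectedOrder (P : PartOrd.{u}) :=
  s.isDirectedOrder_of_mem_posets P.2

instance (P : s.posets.{u}) : LocallyCompactSpace (GeneratingSpace s f P) :=
  locallyCompactSpace_addInfty f

/-- Slices are preimages under the test maps `y ↦ (x, y)` and `x ↦ (x, y)`, hence open. -/
instance (P Q : s.posets.{u}) : IsGeneratedBy (GeneratingSpace.{u} s f)
    (GeneratingSpace s f P × GeneratingSpace s f Q) := by
  rw [IsGeneratedBy.iff_le_generatedBy]
  intro U hU
  have h := WithGeneratedByTopology.isOpen_iff.1 hU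
  exact isOpen_prod_addInfty f U
    (fun x : GeneratingSpace s f P => h (i := Q) ⟨fun y => (x, y), .prodMk_right x⟩)
    (fun y : GeneratingSpace s f Q => h (i := P) ⟨fun x => (x, y), .prodMk_left y⟩)

/-- The category of spaces generated by one of the six classes is cartesian closed. -/
theorem isCartesianClosed_generated (s : Shape) (f : Flavour) :
    IsCartesianClosed (GeneratedByTopCat.{u} (GeneratingSpace.{u} s f)) :=
  isCartesianClosed_generatedByTopCat

end GeneratingSpace

/-! ### Generated spaces are the determined spaces -/

section Determined

variable {X : Type u} [TopologicalSpace X] {s : Shape} {f : Flavour}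

theorem specLE_iff_specializes {x y : X} : SpecLE x y ↔ y ⤳ x :=
  specializes_iff_mem_closure.symm

/-- Two families in `X` are interleaved if every member of each one is below, in the specialization
order, a member of the other. -/
def Interleaved {ι κ : Type*} (g : ι → X) (h : κ → X) : Prop :=
  (∀ i, ∃ j, SpecLE (g i) (h j)) ∧ ∀ j, ∃ i, SpecLE (h j) (g i)

/-- This reduction to a single term is what makes interleaved monotone families interchangeable. -/
theorem Net.IsMonotone.eventuallyIn_of_mem {ξ : Net X} (hξ : ξ.IsMonotone) {U : Set X}
    (hU : ∀ x y, SpecLE x y → x ∈ U → y ∈ U) {i : ξ.index} (hi : ξ.toFun i ∈ U) :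
    ξ.EventuallyIn U :=
  ⟨i, fun j hij => hU _ _ (hξ i j hij) hi⟩

theorem SpecLE.mem_of_isOpen {x y : X} (h : SpecLE x y) {U : Set X} (hU : IsOpen U) (hx : x ∈ U) :
    y ∈ U :=
  (specLE_iff_specializes.1 h).mem_open hU hx

theorem isMonotone_netOfDirected (D : Set X) (hD : IsDirectedSubset D) :
    (netOfDirected D hD).IsMonotone :=
  fun _ _ h => h

theorem Shape.isMonotone_of_mem_nets {ξ : Net X} (hξ : ξ ∈ s.nets X) : ξ.IsMonotone := by
  cases s with
  | directed => obtain ⟨D, hD, rfl⟩ := hξ; exact isMonotone_netOfDirected D hD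
  | chain => obtain ⟨D, hD, rfl⟩ := hξ; exact isMonotone_netOfDirected D hD.1
  | nat => obtain ⟨t, ht, rfl⟩ := hξ; exact ht

theorem isDirectedSubset_range {ι : Type*} [Preorder ι] [Nonempty ι] [IsDirectedOrder ι]
    (g : ι → X) (hg : ∀ i j, i ≤ j → SpecLE (g i) (g j)) : IsDirectedSubset (range g) := by
  refine ⟨range_nonempty g, ?_⟩
  rintro _ ⟨i, rfl⟩ _ ⟨j, rfl⟩
  obtain ⟨k, hik, hjk⟩ := exists_ge_ge i j
  exact ⟨_, ⟨k, rfl⟩, hg _ _ hik, hg _ _ hjk⟩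

theorem specLE_refl (x : X) : SpecLE x x := subset_closure rfl

theorem interleaved_netOfDirected_range {ι : Type*} (g : ι → X)
    (hg : IsDirectedSubset (range g)) : Interleaved (netOfDirected (range g) hg).toFun g := by
  refine ⟨?_, fun j => ⟨⟨_, j, rfl⟩, specLE_refl _⟩⟩
  rintro ⟨_, i, rfl⟩
  exact ⟨i, specLE_refl _⟩

/-- A monotone family indexed by a poset of a given shape is interleaved with a net of that
shape. -/
theorem Shape.exists_net_interleaved (P : s.posets.{u}) (g : P.1 → X)
    (hg : ∀ p q, p ≤ q → SpecLE (g p) (g q)) : ∃ ξ ∈ s.nets X, Interleaved ξ.toFun g := by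
  obtain ⟨P, hP⟩ := P
  cases s with
  | directed =>
    have := hP.1
    have := hP.2
    have hD := isDirectedSubset_range g hg
    exact ⟨_, ⟨_, hD, rfl⟩, interleaved_netOfDirected_range g hD⟩
  | chain =>
    have := hP.1
    have := Shape.isDirectedOrder_of_mem_posets hP
    have hD := isDirectedSubset_range g hg
    refine ⟨_, ⟨_, ⟨hD, ?_⟩, rfl⟩, interleaved_netOfDirected_range g hD⟩
    rintro _ ⟨p, rfl⟩ _ ⟨q, rfl⟩
    exact (hP.2 p q).imp (hg p q) (hg q p)
  | nat =>
    obtain rfl := hP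
    exact ⟨netOfSeq fun n => g ⟨n⟩, ⟨fun n => g ⟨n⟩, fun i j h => hg i j h, rfl⟩,
      fun i => ⟨i, specLE_refl _⟩, fun i => ⟨i, specLE_refl _⟩⟩

/-- A directed subset is interleaved with a monotone family indexed by a poset, the
antisymmetrization of the subset. -/
theorem exists_poset_interleaved (D : Set X) (hD : IsDirectedSubset D) :
    ∃ (P : PartOrd.{u}) (g : P → X), Nonempty P ∧ IsDirectedOrder P ∧
      (∀ p q, p ≤ q ↔ SpecLE (g p) (g q)) ∧ (∀ p, g p ∈ D) ∧
      Interleaved (netOfDirected D hD).toFun g := by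
  let ξ := netOfDirected D hD
  let P := Antisymmetrization ξ.index (· ≤ ·)
  have hle : ∀ p q : P, p ≤ q ↔ SpecLE (ofAntisymmetrization (· ≤ ·) p).1
      (ofAntisymmetrization (· ≤ ·) q).1 := fun p q =>
    ofAntisymmetrization_le_ofAntisymmetrization_iff.symm
  refine ⟨PartOrd.of P, fun p => ξ.toFun (ofAntisymmetrization (· ≤ ·) p),
    ⟨toAntisymmetrization (· ≤ ·) (Classical.arbitrary ξ.index)⟩, ?_, hle,
    fun p => (ofAntisymmetrization (· ≤ ·) p).2, fun i => ?_, fun p => ⟨_, specLE_refl _⟩⟩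
  · refine ⟨fun p q => ?_⟩
    obtain ⟨k, hpk, hqk⟩ := exists_ge_ge (ofAntisymmetrization (· ≤ ·) p)
      (ofAntisymmetrization (· ≤ ·) q)
    refine ⟨toAntisymmetrization (· ≤ ·) k, ?_, ?_⟩
    · rwa [← toAntisymmetrization_ofAntisymmetrization (· ≤ ·) p,
        toAntisymmetrization_le_toAntisymmetrization_iff]
    · rwa [← toAntisymmetrization_ofAntisymmetrization (· ≤ ·) q,
        toAntisymmetrization_le_toAntisymmetrization_iff]
  · refine ⟨toAntisymmetrization (· ≤ ·) i, ?_⟩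
    -- The representative chosen in the class of `i` may differ from `i`, but is equivalent to it.
    change i ≤ ofAntisymmetrization (· ≤ ·) (toAntisymmetrization (· ≤ ·) i)
    rw [← toAntisymmetrization_le_toAntisymmetrization_iff,
      toAntisymmetrization_ofAntisymmetrization]

/-- A net of a given shape is interleaved with a monotone family indexed by a poset of that
shape. -/
theorem Shape.exists_family_interleaved {ξ : Net X} (hξ : ξ ∈ s.nets X) :
    ∃ (P : s.posets.{u}) (g : P.1 → X),
      (∀ p q, p ≤ q → SpecLE (g p) (g q)) ∧ Interleaved ξ.toFun g := by
  cases s with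
  | directed =>
    obtain ⟨D, hD, rfl⟩ := hξ
    obtain ⟨P, g, h₁, h₂, hle, -, h⟩ := exists_poset_interleaved D hD
    exact ⟨⟨P, h₁, h₂⟩, g, fun p q => (hle p q).1, h⟩
  | chain =>
    obtain ⟨D, hD, rfl⟩ := hξ
    obtain ⟨P, g, h₁, -, hle, hgD, h⟩ := exists_poset_interleaved D hD.1
    refine ⟨⟨P, h₁, fun p q => ?_⟩, g, fun p q => (hle p q).1, h⟩
    -- The order of `P` is reflected by `g`, so comparability in `D` passes to `P`.
    rw [hle, hle]
    exact hD.2 _ (hgD p) _ (hgD q)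
  | nat =>
    obtain ⟨t, ht, rfl⟩ := hξ
    exact ⟨⟨_, Shape.nat_mem_posets _⟩, fun n => t n.down, fun p q h => ht p q h,
      fun i => ⟨i, specLE_refl _⟩, fun i => ⟨i, specLE_refl _⟩⟩

/-- Constant nets at `y` are admitted at every `x ⊑ y`, which forces sets open for an operation to
be upper sets. -/
theorem exists_const_mem_nets (s : Shape) (y : X) : ∃ ξ ∈ s.nets X, ∀ i, ξ.toFun i = y := by
  have hD : IsPreChain ({y} : Set X) :=
    ⟨⟨⟨y, rfl⟩, fun a ha b hb => ⟨y, rfl, ha ▸ specLE_refl _, hb ▸ specLE_refl _⟩⟩,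
      fun a ha b hb => Or.inl (by rw [ha, hb]; exact specLE_refl _)⟩
  cases s with
  | directed => exact ⟨_, ⟨_, hD.1, rfl⟩, fun i => i.2⟩
  | chain => exact ⟨_, ⟨_, hD, rfl⟩, fun i => i.2⟩
  | nat => exact ⟨_, ⟨fun _ => y, fun _ _ _ => specLE_refl _, rfl⟩, fun _ => rfl⟩

theorem admits_of_forall_eq {ξ : Net X} {x y : X} (hξ : ∀ i, ξ.toFun i = y) (h : SpecLE x y) :
    f.Admits ξ x := by
  cases f with
  | β => exact fun V hV hx => ⟨Classical.arbitrary _, fun j _ => hξ j ▸ h.mem_of_isOpen hV hx⟩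
  | γ => exact Or.inl ⟨Classical.arbitrary _, (hξ _).symm ▸ h⟩

/-- Sets that are open for the topology determined by an operation are upper sets. -/
theorem mem_of_specLE_of_isOpen_operation {U : Set X}
    (hU : IsOpen[(operation s f X).topology] U) {x y : X} (h : SpecLE x y) (hx : x ∈ U) :
    y ∈ U := by
  obtain ⟨ξ, hξ, hy⟩ := exists_const_mem_nets s y
  obtain ⟨i, hi⟩ := hU ξ x ⟨hξ, admits_of_forall_eq hy h⟩ hx
  exact hy i ▸ hi i le_rfl

/-- Sets whose preimages in all generating spaces are open are upper sets. -/
theorem mem_of_specLE_of_isOpen_preimage {U : Set X}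
    (hU : ∀ (P : s.posets.{u}) (k : C(GeneratingSpace s f P, X)), IsOpen (k ⁻¹' U)) {x y : X}
    (h : SpecLE x y) (hx : x ∈ U) : y ∈ U := by
  let P : s.posets.{u} := ⟨_, s.nat_mem_posets⟩
  -- Value `x` at `0` and `y` elsewhere: monotone since `x ⊑ y`, eventually constant, and bounded by
  -- its value at `∞`, so continuous for both flavours.
  let k : AddInfty (ULift.{u} ℕ) → X := fun z => match z with
    | .of ⟨0⟩ => x
    | .of ⟨_ + 1⟩ => y
    | .infty => y
  have hk : Continuous (fun z : GeneratingSpace s f P => k z) := by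
    refine continuous_addInfty (P := P.1) f k ?_ (fun V _ hV => ⟨⟨1⟩, ?_⟩) ?_
    · rintro ⟨_ | p⟩ ⟨_ | q⟩ hpq
      · exact specLE_refl _
      · exact h
      · exact absurd hpq (Nat.not_succ_le_zero p)
      · exact specLE_refl _
    · rintro ⟨_ | q⟩ hq
      · exact absurd hq (Nat.not_succ_le_zero 0)
      · exact hV
    · rintro - ⟨_ | p⟩
      · exact h
      · exact specLE_refl _
  exact ((isOpen_addInfty_iff (P := P.1) f _).1 (hU P ⟨_, hk⟩)).1 ⟨0⟩ ⟨1⟩ (Nat.zero_le 1) hx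

/-- A set is open for the topology determined by an operation iff its preimages in all spaces of
the corresponding generating class are open. -/
theorem isOpen_operation_iff (U : Set X) : IsOpen[(operation s f X).topology] U ↔
    ∀ (P : s.posets.{u}) (k : C(GeneratingSpace s f P, X)), IsOpen (k ⁻¹' U) := by
  refine ⟨fun hU P k => ?_, ?_⟩
  · let g : P.1 → X := fun p => k (.of p)
    have hk : ∀ V : Set X, IsOpen V → _ := fun V hV =>
      (isOpen_addInfty_iff (P := P.1) f _).1 (hV.preimage k.continuous)
    have hg : ∀ p q, p ≤ q → SpecLE (g p) (g q) := fun p q hpq =>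
      specLE_iff_specializes.2 (specializes_iff_forall_open.2 fun V hV => (hk V hV).1 p q hpq)
    have hgU : ∀ p q : P.1, p ≤ q → g p ∈ U → g q ∈ U := fun p q hpq =>
      mem_of_specLE_of_isOpen_operation hU (hg p q hpq)
    have hinf : f = .γ → ∀ p, SpecLE (g p) (k .infty) := fun hf p =>
      specLE_iff_specializes.2 (specializes_iff_forall_open.2 fun V hV => (hk V hV).2.2 hf p)
    refine (isOpen_addInfty_iff (P := P.1) f _).2 ⟨hgU, fun hx => ?_,
      fun hf p => mem_of_specLE_of_isOpen_operation hU (hinf hf p)⟩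
    -- `g` need not be a net of the kind the operation allows, so an interleaved net replaces it.
    obtain ⟨ξ, hξ, hξg, hgξ⟩ := s.exists_net_interleaved P g hg
    have hconv : ξ.ConvergesTo (k .infty) := fun V hV hxV => by
      obtain ⟨p, hp⟩ := (hk V hV).2.1 hxV
      obtain ⟨i, hi⟩ := hgξ p
      exact (s.isMonotone_of_mem_nets hξ).eventuallyIn_of_mem
        (fun _ _ h => h.mem_of_isOpen hV) (hi.mem_of_isOpen hV (hp p le_rfl))
    have hadm : f.Admits ξ (k .infty) := by
      cases f with
      | β => exact hconv
      | γ =>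
        refine Or.inr ⟨hconv, fun i => ?_⟩
        obtain ⟨p, hp⟩ := hξg i
        exact (specPreorder X).le_trans _ _ _ hp (hinf rfl p)
    obtain ⟨i, hi⟩ := hU ξ _ ⟨hξ, hadm⟩ hx
    obtain ⟨p, hp⟩ := hξg i
    exact ⟨p, fun q hq => hgU p q hq (mem_of_specLE_of_isOpen_operation hU hp (hi i le_rfl))⟩
  · rintro hU ξ x ⟨hξ, hx⟩ hxU
    have hup : ∀ x y, SpecLE x y → x ∈ U → y ∈ U := fun _ _ =>
      mem_of_specLE_of_isOpen_preimage hU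
    have hmono := s.isMonotone_of_mem_nets hξ
    obtain ⟨P, g, hg, hξg, hgξ⟩ := s.exists_family_interleaved hξ
    have main : ξ.ConvergesTo x → (f = .γ → ∀ j, SpecLE (ξ.toFun j) x) → ξ.EventuallyIn U := by
      intro hconv hle
      -- The family together with the limit `x` at `∞` forms a test map.
      let k : AddInfty P.1 → X := fun z => match z with
        | .of p => g p
        | .infty => x
      have hk : Continuous (fun z : GeneratingSpace s f P => k z) := by
        refine continuous_addInfty (P := P.1) f k hg (fun V hV hxV => ?_) fun hf p => ?_
        · obtain ⟨i, hi⟩ := hconv V hV hxV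
          obtain ⟨p, hp⟩ := hξg i
          exact ⟨p, fun q hq => (hg p q hq).mem_of_isOpen hV (hp.mem_of_isOpen hV (hi i le_rfl))⟩
        · obtain ⟨i, hi⟩ := hgξ p
          exact (specPreorder X).le_trans _ _ _ hi (hle hf i)
      obtain ⟨p, hp⟩ := ((isOpen_addInfty_iff (P := P.1) f _).1 (hU P ⟨_, hk⟩)).2.1 hxU
      obtain ⟨i, hi⟩ := hgξ p
      exact hmono.eventuallyIn_of_mem hup (hup _ _ hi (hp p le_rfl))
    cases f with
    | β => exact main hx fun h => by cases h
    | γ =>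
      -- If `x` is below a term, no test map at `∞` is needed: `U` is an upper set.
      obtain ⟨j, hj⟩ | h := hx
      · exact hmono.eventuallyIn_of_mem hup (hup _ _ hj hxU)
      · exact main h.1 fun _ => h.2

end Determined

/-- The generated spaces are the determined spaces. -/
theorem generatedBy_eq_determinedBy (s : Shape) (f : Flavour) :
    TopCat.generatedBy.{u} (GeneratingSpace.{u} s f) = determinedBy.{u} s f := by
  funext X
  refine propext ⟨fun h => TopologicalSpace.ext_iff.2 fun U => ?_, fun h => ?_⟩
  · have : IsGeneratedBy (GeneratingSpace.{u} s f) X := h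
    rw [isOpen_operation_iff, IsGeneratedBy.isOpen_iff (GeneratingSpace.{u} s f)]
  · refine IsGeneratedBy.iff_le_generatedBy.2 fun U hU => ?_
    exact (TopologicalSpace.ext_iff.1 h U).1
      ((isOpen_operation_iff U).2 fun P k => WithGeneratedByTopology.isOpen_iff.1 hU k)

/-- The spaces determined by their directed subsets are the monotone determined spaces. -/
theorem determinedBy_directed_eq_monotoneDetermined :
    determinedBy.{u} .directed .β = monotoneDetermined.{u} := by
  funext X
  have key : ∀ U : Set X, IsOpen[(operation .directed .β X).topology] U ↔
      ∀ ξ : Net X, ξ.IsMonotone → ∀ x ∈ U, ξ.ConvergesTo x → ξ.EventuallyIn U := by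
    refine fun U => ⟨fun hU ξ hξ x hx hconv => ?_, fun hU ξ x ⟨hξ, hx⟩ hxU => ?_⟩
    -- The range carries its own order, possibly unlike that of `ξ`; for upper sets one common term
    -- suffices.
    · have hD := isDirectedSubset_range ξ.toFun hξ
      have hmem : ∀ {V : Set X}, (∀ x y, SpecLE x y → x ∈ V → y ∈ V) → ξ.EventuallyIn V →
          (netOfDirected _ hD).EventuallyIn V := fun hV ⟨i, hi⟩ =>
        (isMonotone_netOfDirected _ hD).eventuallyIn_of_mem (i := ⟨_, i, rfl⟩) hV (hi i le_rfl)
      obtain ⟨⟨_, i, rfl⟩, hi⟩ := hU (netOfDirected _ hD) x ⟨⟨_, hD, rfl⟩, fun V hV hxV =>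
        hmem (fun _ _ h => h.mem_of_isOpen hV) (hconv V hV hxV)⟩ hx
      exact hξ.eventuallyIn_of_mem (fun _ _ => mem_of_specLE_of_isOpen_operation hU)
        (hi ⟨_, i, rfl⟩ (specLE_refl _))
    · exact hU ξ (Shape.isMonotone_of_mem_nets hξ) x hxU hx
  refine propext ⟨fun h U => ?_, fun h => TopologicalSpace.ext_iff.2 fun U => ?_⟩
  · exact (TopologicalSpace.ext_iff.1 h U).symm.trans (key U)
  · rw [key, h]

end DeterminedSpace

theorem mainTheorem2 :
    (∀ (s : DeterminedSpace.Shape) (f : DeterminedSpace.Flavour),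
      DeterminedSpace.IsCartesianClosed
          (GeneratedByTopCat.{u} (DeterminedSpace.GeneratingSpace.{u} s f)) ∧
        TopCat.generatedBy.{u} (DeterminedSpace.GeneratingSpace.{u} s f) =
          DeterminedSpace.determinedBy.{u} s f ∧
        DeterminedSpace.IsCartesianClosed
          (DeterminedSpace.determinedBy.{u} s f).FullSubcategory) ∧
    DeterminedSpace.determinedBy.{u} .directed .β = DeterminedSpace.monotoneDetermined.{u} ∧
    DeterminedSpace.IsCartesianClosed DeterminedSpace.monotoneDetermined.{u}.FullSubcategory := by
  have hdet : ∀ (s : DeterminedSpace.Shape) (f : DeterminedSpace.Flavour),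
      DeterminedSpace.IsCartesianClosed
        (DeterminedSpace.determinedBy.{u} s f).FullSubcategory := fun s f =>
    DeterminedSpace.generatedBy_eq_determinedBy.{u} s f ▸
      DeterminedSpace.isCartesianClosed_generated.{u} s f
  exact ⟨fun s f => ⟨DeterminedSpace.isCartesianClosed_generated s f,
      DeterminedSpace.generatedBy_eq_determinedBy s f, hdet s f⟩,
    DeterminedSpace.determinedBy_directed_eq_monotoneDetermined,
    DeterminedSpace.determinedBy_directed_eq_monotoneDetermined.{u} ▸ hdet .directed .β⟩
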